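/- Let $\mathcal G=(\mathcal V,\mathcal E,W)$ be a strongly connected weighted digraph with vertex set $\mathcal V=\{1,\dots,n\}$ and nonnegative weighted adjacency matrix $W$ (there is an arc from $i$ to $j$ iff $W_{ij}>0$), and let $k$ be an integer with $2\le k\le n$. Put $d_i=\sum_j W_{ij}$, $d_{\mathcal G}=\sum_i d_i$ and $P_{ij}=W_{ij}/d_i$; let $\pi$ be the stationary distribution of the random walk on $\mathcal V$ with transition matrix $P$, and let $L=d_{\mathcal G}\,\mathrm{Diag}(\pi)(I-P)$ be the Laplacian of $\mathcal G$, with Moore–Penrose inverse $L^\dagger$. For a nonempty $\mathcal X\subseteq\mathcal V$ and $i\notin\mathcal X$ let $P_{\mathrm{es}}(i,\mathcal X)$ be the probability that the random walk started at $i$ reaches a vertex of $\mathcal X$ before it returns to $i$, and put $$\Omega(i,\mathcal X)=\frac1{d_{\mathcal G}\,\pi_i\,P_{\mathrm{es}}(i,\mathcal X)}\quad(i\notin\mathcal X),\qquad \Omega(i,\mathcal X)=0\quad(i\in\mathcal X),\qquad \Omega(\mathcal X)=\sum_{i\in\mathcal V}\Omega(i,\mathcal X),$$ and, for vertices, $\Omega(i,j)=\Omega(i,\{j\})$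 and $\Omega(v)=\sum_{j\in\mathcal V}\Omega(v,j)$. Write $L_{\setminus\mathcal X}$ for $L$ with the rows and columns of $\mathcal X$ removed. The greedy algorithm Exact, with input $L$ and $k$, selects $v_1\in\arg\min_{v\in\mathcal V}\bigl(n L^\dagger_{vv}+\mathrm{Tr}\,L^\dagger\bigr)$ and sets $\mathcal X=\{v_1\}$, $M=L_{\setminus\{v_1\}}^{-1}$. Then, for $i=2,\dots,k$, it selects $$v_i\in\arg\max_{v\in\mathcal V\setminus\mathcal X}\Delta(\mathcal X,v),\qquad \Delta(\mathcal X,v)=\frac{e_v^\top M^2e_v}{e_v^\top M e_v},$$ replaces $M$ by $M-\frac{M e_{v_i}e_{v_i}^\top M}{e_{v_i}^\top M e_{v_i}}$ with the row and column of $v_i$ removed, and adds $v_i$ to $\mathcal X$. Ties are broken arbitrarily. Finally it returns $\mathcal X$. **Theorem.** The algorithm can always be run to the end, and every set $\mathcal X$ that it can return satisfies $|\mathcal X|=k$ and $$\Omega(v^*)-\Omega(\mathcal X)\ \ge\ \Bigl(1-\frac{k}{k-1}\cdot\frac1e\Bigr)\bigl(\Omega(v^*)-\Omega(\mathcal X^*)\bigr),$$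 where $v^*$ is any vertex that minimizes $\Omega(v)$ over $v\in\mathcal V$, and $\mathcal X^*$ is any set that minimizes $\Omega$ over the $k$-element subsets of $\mathcal V$, or over the nonempty subsets of $\mathcal V$ with at most $k$ elements. -/

import Mathlib

/-!
Let `g` be the inverse of the Laplacian from which the vertices of `X` are removed. The function
`h = 1 - g(·, i) / g(i, i)` is harmonic outside `X` and `i`, where it takes the values one and zero,
so the walk stopped on meeting `X` or returning to `i` escapes with probability `(P h) i`, and
`Ω(i, X) = g(i, i)`: the resistance of a group is the trace of `g`.

The minimum principle for the Laplacian shows that `g(i, j)` and the hitting probabilities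
`g(i, v) / g(v, v)` decrease when `X` grows; as the rank-one update of the inverse expresses the
marginal gain of `v` through these quantities, `Ω` is antitone and supermodular on nonempty sets.

The columns of the Laplacian sum to zero as well, which makes `n L†ᵥᵥ + Tr L† = Ω({v}) = Ω(v)`, so
the first selection is an optimal single vertex. Each of the remaining `k - 1` selections multiplies
the gap to any competitor of at most `k` vertices by at most `1 - 1 / k`, and
`(1 - 1 / k) ^ (k - 1) ≤ k / (k - 1) * e⁻¹`.
-/

open MeasureTheory ProbabilityTheory

/-- The Moore-Penrose conditions: `B` is the pseudoinverse of the real square matrix `A`. -/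
def IsMoorePenrose {n : ℕ} (A B : Matrix (Fin n) (Fin n) ℝ) : Prop :=
  A * B * A = A ∧ B * A * B = B ∧ (A * B).transpose = A * B ∧ (B * A).transpose = B * A

open Classical in
/-- The Moore-Penrose inverse of a real square matrix, i.e. the matrix that satisfies the four
Moore-Penrose conditions. -/
noncomputable def pinv {n : ℕ} (A : Matrix (Fin n) (Fin n) ℝ) : Matrix (Fin n) (Fin n) ℝ :=
  if h : ∃ B, IsMoorePenrose A B then h.choose else 0

/-- A weighted digraph on the vertices `0, …, n - 1`, given by its nonnegative weighted adjacency
matrix; there is an arc from `i` to `j` exactly when `W i j` is positive. -/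
structure WeightedDigraph (n : ℕ) where
  W : Matrix (Fin n) (Fin n) ℝ
  nonneg : ∀ i j, 0 ≤ W i j

namespace WeightedDigraph

variable {n : ℕ} (G : WeightedDigraph n)

/-- There is an arc from `i` to `j`. -/
def Adj (i j : Fin n) : Prop := 0 < G.W i j

/-- Every vertex is reachable from every vertex along arcs. -/
def StronglyConnected : Prop := ∀ i j, Relation.ReflTransGen G.Adj i j

/-- The (out-)degree of a vertex. -/
noncomputable def deg (i : Fin n) : ℝ := ∑ j, G.W i j

/-- The volume of the digraph. -/
noncomputable def vol : ℝ := ∑ i, G.deg i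

/-- The transition matrix of the random walk. -/
noncomputable def P : Matrix (Fin n) (Fin n) ℝ := Matrix.of fun i j => G.W i j / G.deg i

open Classical in
/-- The stationary distribution of the random walk: the probability vector `p` with `pᵀ P = pᵀ`. -/
noncomputable def stationary : Fin n → ℝ :=
  if h : ∃ p : Fin n → ℝ, p ∈ stdSimplex ℝ (Fin n) ∧ Matrix.vecMul p G.P = p
  then h.choose else 0

theorem sum_ofReal_P {i : Fin n} (h : G.deg i ≠ 0) : ∑ j, ENNReal.ofReal (G.P i j) = 1 := by
  have h0 : 0 ≤ G.deg i := Finset.sum_nonneg fun j _ => G.nonneg i j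
  have h1 : ∀ j ∈ Finset.univ, 0 ≤ G.P i j := fun j _ => div_nonneg (G.nonneg i j) h0
  have h2 : ∑ j, G.P i j = 1 := by
    simp only [P, Matrix.of_apply]
    rw [← Finset.sum_div]
    exact div_self h
  rw [← ENNReal.ofReal_sum_of_nonneg h1, h2, ENNReal.ofReal_one]

open Classical in
/-- The law of one jump from `i`: the walk moves to `j` with probability `P i j`. (A vertex without
outgoing arcs, which a strongly connected digraph with two or more vertices does not have, is made
absorbing.) -/
noncomputable def stepLaw (i : Fin n) : PMF (Fin n) :=
  if h : G.deg i ≠ 0 then PMF.ofFintype (fun j => ENNReal.ofReal (G.P i j)) (G.sum_ofReal_P h)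
  else PMF.pure i

/-- The one-step Markov kernel of the random walk. -/
noncomputable def stepKernel : Kernel (Fin n) (Fin n) :=
  Kernel.ofFunOfCountable fun i => (G.stepLaw i).toMeasure

instance : IsMarkovKernel G.stepKernel :=
  ⟨fun i => by
    change IsProbabilityMeasure (G.stepLaw i).toMeasure
    infer_instance⟩

/-- The transition from the history `x 0, …, x t` to `x (t + 1)`: it depends only on `x t`. -/
noncomputable def historyKernel (t : ℕ) :
    Kernel ((s : Finset.Iic t) → (fun _ : ℕ => Fin n) s) ((fun _ : ℕ => Fin n) (t + 1)) :=
  G.stepKernel.comap (fun x => x ⟨t, Finset.mem_Iic.2 le_rfl⟩) (measurable_pi_apply _)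

instance (t : ℕ) : IsMarkovKernel (G.historyKernel t) := by
  unfold historyKernel
  infer_instance

/-- The law, on the space of trajectories `ℕ → Fin n`, of the random walk started at `i`. -/
noncomputable def walkLaw (i : Fin n) : Measure (ℕ → Fin n) :=
  Kernel.trajMeasure (X := fun _ => Fin n) (Measure.dirac i) G.historyKernel

/-- The escape probability from `i` to `X`: the probability that the random walk started at `i`
reaches some vertex of `X` before it returns to `i`. -/
noncomputable def escapeProb (i : Fin n) (X : Finset (Fin n)) : ℝ :=
  (G.walkLaw i).real {w | ∃ t, 1 ≤ t ∧ w t ∈ X ∧ ∀ s, 1 ≤ s → s < t → w s ≠ i}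

/-- The resistance distance between two vertices. -/
noncomputable def resistance (i j : Fin n) : ℝ :=
  if i = j then 0 else 1 / (G.vol * G.stationary i * G.escapeProb i {j})

/-- The resistance distance of a vertex. -/
noncomputable def vertexResistance (i : Fin n) : ℝ := ∑ j, G.resistance i j

/-- The resistance distance between a vertex and a nonempty vertex group; it is zero for the
vertices of the group. -/
noncomputable def resistanceTo (i : Fin n) (X : Finset (Fin n)) : ℝ :=
  if i ∈ X then 0 else 1 / (G.vol * G.stationary i * G.escapeProb i X)

/-- The resistance distance of a nonempty vertex group. -/
noncomputable def groupResistance (X : Finset (Fin n)) : ℝ := ∑ i, G.resistanceTo i X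

/-- The Laplacian matrix of a digraph. -/
noncomputable def laplacian : Matrix (Fin n) (Fin n) ℝ :=
  G.vol • (Matrix.diagonal G.stationary * (1 - G.P))

end WeightedDigraph

namespace Exact

variable {n : ℕ}

/-- `A` with the rows and columns of the vertices in `X` removed. -/
def removed (A : Matrix (Fin n) (Fin n) ℝ) (X : Finset (Fin n)) :
    Matrix {u // u ∉ X} {u // u ∉ X} ℝ :=
  A.submatrix Subtype.val Subtype.val

/-- The marginal gain `Δ(X, v)`, as the algorithm evaluates it from the maintained matrix `M`, which
stands for the inverse of the Laplacian with the rows and columns of `X` removed. -/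
noncomputable def gain {X : Finset (Fin n)} (M : Matrix {u // u ∉ X} {u // u ∉ X} ℝ)
    (v : {u // u ∉ X}) : ℝ :=
  (M * M) v v / M v v

/-- The update of the maintained matrix when `v` is added to `X`: the rank-one correction
`M - (M e_v e_vᵀ M) / (e_vᵀ M e_v)`, from which the row and column of `v` are removed. -/
noncomputable def update {X : Finset (Fin n)} (M : Matrix {u // u ∉ X} {u // u ∉ X} ℝ)
    (v : {u // u ∉ X}) : Matrix {u // u ∉ insert v.1 X} {u // u ∉ insert v.1 X} ℝ :=
  Matrix.of fun a b =>
    let a' : {u // u ∉ X} := ⟨a.1, fun h => a.2 (Finset.mem_insert_of_mem h)⟩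
    let b' : {u // u ∉ X} := ⟨b.1, fun h => b.2 (Finset.mem_insert_of_mem h)⟩
    M a' b' - M a' v * M v b' / M v v

/-- `State L i X M`: with input the matrix `L`, the algorithm can hold the set `X` and the matrix
`M` after `i` vertices have been selected. Ties in the `argmin` of the first selection and in the
`argmax` of the later ones may be broken in any way. -/
inductive State (L : Matrix (Fin n) (Fin n) ℝ) :
    ℕ → (X : Finset (Fin n)) → Matrix {u // u ∉ X} {u // u ∉ X} ℝ → Prop
  | init (v : Fin n)
      (hv : ∀ u, n * pinv L v v + (pinv L).trace ≤ n * pinv L u u + (pinv L).trace) :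
      State L 1 {v} (removed L {v})⁻¹
  | step {i : ℕ} {X : Finset (Fin n)} {M : Matrix {u // u ∉ X} {u // u ∉ X} ℝ}
      (h : State L i X M) (v : {u // u ∉ X}) (hv : ∀ u, gain M u ≤ gain M v) :
      State L (i + 1) (insert v.1 X) (update M v)

/-- The algorithm, run with input the matrix `L` and the number `k`, can return the set `X`. -/
def Returns (L : Matrix (Fin n) (Fin n) ℝ) (k : ℕ) (X : Finset (Fin n)) : Prop :=
  ∃ M, State L k X M

end Exact

section Supermodular

variable {α : Type*} [DecidableEq α] {f : Finset α → ℝ} {X Y : Finset α} {v : α} {k : ℕ}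

/-- The decrease of the set function `f` when `v` is added to `X`. -/
def decrement (f : Finset α → ℝ) (X : Finset α) (v : α) : ℝ := f X - f (insert v X)

/-- An antitone supermodular set function. Nothing is asked of the value at the empty set, since the
resistance distance of a vertex group is meaningful for nonempty groups only. -/
structure IsAntitoneSupermodular (f : Finset α → ℝ) : Prop where
  le_of_subset {X Y : Finset α} : X.Nonempty → X ⊆ Y → f Y ≤ f X
  decrement_le {X Y : Finset α} {v : α} :
    X.Nonempty → X ⊆ Y → v ∉ Y → decrement f Y v ≤ decrement f X v

theorem decrement_of_mem (hv : v ∈ X) : decrement f X v = 0 := by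
  rw [decrement, Finset.insert_eq_of_mem hv, sub_self]

namespace IsAntitoneSupermodular

theorem decrement_nonneg (hf : IsAntitoneSupermodular f) (hX : X.Nonempty) (v : α) :
    0 ≤ decrement f X v :=
  sub_nonneg.2 (hf.le_of_subset hX (Finset.subset_insert v X))

theorem sub_union_le_sum_decrement (hf : IsAntitoneSupermodular f) (hX : X.Nonempty)
    (Y : Finset α) : f X - f (X ∪ Y) ≤ ∑ y ∈ Y, decrement f X y := by
  induction Y using Finset.induction_on with
  | empty => simp
  | insert y Y hy ih =>
    have hdec : decrement f (X ∪ Y) y ≤ decrement f X y := by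
      by_cases hmem : y ∈ X ∪ Y
      · exact (decrement_of_mem hmem).trans_le (hf.decrement_nonneg hX y)
      · exact hf.decrement_le hX Finset.subset_union_left hmem
    rw [Finset.union_insert, Finset.sum_insert hy]
    rw [decrement] at hdec
    linarith

theorem greedy_step (hf : IsAntitoneSupermodular f) (hX : X.Nonempty) (hY : Y.Nonempty)
    (hYk : Y.card ≤ k) (hv : ∀ u ∉ X, decrement f X u ≤ decrement f X v) :
    f (insert v X) - f Y ≤ (1 - 1 / (k : ℝ)) * (f X - f Y) := by
  have hv_nonneg := hf.decrement_nonneg hX v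
  have hmax (u : α) : decrement f X u ≤ decrement f X v := by
    by_cases hu : u ∈ X
    · rwa [decrement_of_mem hu]
    · exact hv u hu
  have hk : (0 : ℝ) < k := Nat.cast_pos.2 (hY.card_pos.trans_le hYk)
  have hgap : f X - f Y ≤ k * decrement f X v :=
    calc f X - f Y ≤ f X - f (X ∪ Y) :=
          sub_le_sub_left (hf.le_of_subset hY Finset.subset_union_right) _
      _ ≤ ∑ y ∈ Y, decrement f X y := hf.sub_union_le_sum_decrement hX Y
      _ ≤ Y.card * decrement f X v := by
          simpa using Finset.sum_le_card_nsmul Y _ _ fun u _ => hmax u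
      _ ≤ k * decrement f X v := by gcongr
  have hshare : 1 / (k : ℝ) * (f X - f Y) ≤ decrement f X v := by
    rwa [one_div_mul_eq_div, div_le_iff₀' hk]
  rw [decrement] at hshare
  linarith

end IsAntitoneSupermodular

end Supermodular

section InvAddProjection

variable {ι R : Type*} [Fintype ι] [DecidableEq ι] [CommRing R] {A J : Matrix ι ι R}

theorem mul_inv_add_sub_eq (hJ : J * J = J) (hAJ : A * J = 0) (hJA : J * A = 0)
    (hunit : IsUnit (A + J)) : A * ((A + J)⁻¹ - J) = 1 - J := by
  have hdet := (Matrix.isUnit_iff_isUnit_det _).1 hunit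
  have hJinv : J * (A + J)⁻¹ = J := by
    simpa only [mul_add, hJA, hJ, zero_add] using Matrix.mul_nonsing_inv_cancel_right (A + J) J hdet
  rw [mul_sub, hAJ, sub_zero, eq_sub_iff_add_eq]
  simpa only [add_mul, hJinv] using Matrix.mul_nonsing_inv (A + J) hdet

theorem inv_add_sub_mul_eq (hJ : J * J = J) (hAJ : A * J = 0) (hJA : J * A = 0)
    (hunit : IsUnit (A + J)) : ((A + J)⁻¹ - J) * A = 1 - J := by
  have hdet := (Matrix.isUnit_iff_isUnit_det _).1 hunit
  have hinvJ : (A + J)⁻¹ * J = J := by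
    simpa only [add_mul, hAJ, hJ, zero_add] using Matrix.nonsing_inv_mul_cancel_left (A + J) J hdet
  rw [sub_mul, hJA, sub_zero, eq_sub_iff_add_eq]
  simpa only [mul_add, hinvJ] using Matrix.nonsing_inv_mul (A + J) hdet

end InvAddProjection

section MoorePenrose

open scoped Matrix

variable {n : ℕ} {A B C J : Matrix (Fin n) (Fin n) ℝ} {x : Fin n → ℝ}

namespace IsMoorePenrose

theorem unique (hB : IsMoorePenrose A B) (hC : IsMoorePenrose A C) : B = C := by
  obtain ⟨hABA, hBAB, hABt, hBAt⟩ := hB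
  obtain ⟨hACA, hCAC, hACt, hCAt⟩ := hC
  have hright : A * B = A * C :=
    calc A * B = (A * C * (A * B))ᵀ := by rw [← mul_assoc, hACA, hABt]
      _ = A * B * (A * C) := by rw [Matrix.transpose_mul, hABt, hACt]
      _ = A * C := by rw [← mul_assoc, hABA]
  have hleft : B * A = C * A :=
    calc B * A = (B * A * (C * A))ᵀ := by rw [mul_assoc B, ← mul_assoc A, hACA, hBAt]
      _ = C * A * (B * A) := by rw [Matrix.transpose_mul, hBAt, hCAt]
      _ = C * A := by rw [mul_assoc, ← mul_assoc A, hABA]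
  calc B = C * A * B := by rw [← hleft, hBAB]
    _ = C := by rw [mul_assoc, hright, ← mul_assoc, hCAC]

theorem pinv_eq (hB : IsMoorePenrose A B) : pinv A = B := by
  have hex : ∃ B, IsMoorePenrose A B := ⟨B, hB⟩
  rw [pinv, dif_pos hex]
  exact hex.choose_spec.unique hB

theorem mulVec_eq_zero (hB : IsMoorePenrose A B) (hx : x ᵥ* A = 0) : B *ᵥ x = 0 := by
  obtain ⟨-, hBAB, hABt, -⟩ := hB
  have hfactor : B = B * Bᵀ * Aᵀ := by
    rw [mul_assoc, ← Matrix.transpose_mul, hABt, ← mul_assoc, hBAB]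
  rw [hfactor, ← Matrix.mulVec_mulVec, Matrix.mulVec_transpose, hx, Matrix.mulVec_zero]

theorem vecMul_eq_zero (hB : IsMoorePenrose A B) (hx : A *ᵥ x = 0) : x ᵥ* B = 0 := by
  obtain ⟨-, hBAB, -, hBAt⟩ := hB
  have hfactor : B = Aᵀ * (Bᵀ * B) := by
    rw [← mul_assoc, ← Matrix.transpose_mul, hBAt, hBAB]
  rw [hfactor, ← Matrix.vecMul_vecMul, Matrix.vecMul_transpose, hx, Matrix.zero_vecMul]

end IsMoorePenrose

theorem isMoorePenrose_inv_add_sub (hJ : J * J = J) (hJt : Jᵀ = J) (hAJ : A * J = 0)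
    (hJA : J * A = 0) (hunit : IsUnit (A + J)) : IsMoorePenrose A ((A + J)⁻¹ - J) := by
  have hright := mul_inv_add_sub_eq hJ hAJ hJA hunit
  have hleft := inv_add_sub_mul_eq hJ hAJ hJA hunit
  have hinvJ : ((A + J)⁻¹ - J) * J = 0 := by
    have hdet := (Matrix.isUnit_iff_isUnit_det _).1 hunit
    rw [sub_mul, hJ, sub_eq_zero]
    simpa only [add_mul, hAJ, hJ, zero_add] using
      Matrix.nonsing_inv_mul_cancel_left (A + J) J hdet
  refine ⟨?_, ?_, ?_, ?_⟩
  · rw [hright, sub_mul, one_mul, hJA, sub_zero]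
  · rw [mul_assoc, hright, mul_sub, mul_one, hinvJ, sub_zero]
  · rw [hright, Matrix.transpose_sub, Matrix.transpose_one, hJt]
  · rw [hleft, Matrix.transpose_sub, Matrix.transpose_one, hJt]

end MoorePenrose

section IrreducibleLaplacian

open scoped Matrix

variable {ι : Type*} [Fintype ι] {L B : Matrix ι ι ℝ} {X Y : Finset ι} {x : ι → ℝ}
  {a b i j v : ι}

/-- The Laplacian of a strongly connected weighted digraph: the off-diagonal entries are
nonpositive, the rows sum to zero, and the arcs, the pairs with a negative entry, connect every
vertex to every vertex. -/
structure IsIrreducibleLaplacian (L : Matrix ι ι ℝ) : Prop where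
  nonpos_of_ne {i j : ι} : i ≠ j → L i j ≤ 0
  mulVec_one : L *ᵥ 1 = 0
  connected (i j : ι) : Relation.ReflTransGen (fun a b => L a b < 0) i j

namespace IsIrreducibleLaplacian

theorem mulVec_apply_eq_sum_sub (hL : IsIrreducibleLaplacian L) (x : ι → ℝ) (i : ι) :
    (L *ᵥ x) i = ∑ j, L i j * (x j - x i) := by
  have hrow : ∑ j, L i j = 0 := by
    simpa [Matrix.mulVec_apply_eq_sum] using congrFun hL.mulVec_one i
  simp only [mul_sub, Finset.sum_sub_distrib, ← Finset.sum_mul, hrow, zero_mul, sub_zero,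
    Matrix.mulVec_apply_eq_sum]

theorem eq_of_isMin (hL : IsIrreducibleLaplacian L) (hmin : ∀ j, x a ≤ x j)
    (hsuper : 0 ≤ (L *ᵥ x) a) (hab : L a b < 0) : x b = x a := by
  rw [hL.mulVec_apply_eq_sum_sub] at hsuper
  have hterm : ∀ j ∈ Finset.univ, L a j * (x j - x a) ≤ 0 := fun j _ => by
    rcases eq_or_ne a j with rfl | haj
    · simp
    · exact mul_nonpos_of_nonpos_of_nonneg (hL.nonpos_of_ne haj) (sub_nonneg.2 (hmin j))
  have hzero := (Finset.sum_eq_zero_iff_of_nonpos hterm).1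
    (hsuper.antisymm' (Finset.sum_nonpos hterm)) b (Finset.mem_univ b)
  exact sub_eq_zero.1 ((mul_eq_zero_iff_left hab.ne).1 hzero)

theorem nonneg_of_mulVec_nonneg (hL : IsIrreducibleLaplacian L) (hX : X.Nonempty)
    (hbdry : ∀ i ∈ X, 0 ≤ x i) (hsuper : ∀ i ∉ X, 0 ≤ (L *ᵥ x) i) (i : ι) : 0 ≤ x i := by
  have : Nonempty ι := ⟨i⟩
  obtain ⟨m, hm⟩ := Finite.exists_min x
  by_contra! hi
  have hneg : x m < 0 := (hm i).trans_lt hi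
  have hconst (j : ι) : x j = x m := by
    induction hL.connected m j with
    | refl => rfl
    | @tail b c _ hbc hb =>
      have hbX : b ∉ X := fun hbX => ((hbdry b hbX).trans_eq hb).not_gt hneg
      exact (hL.eq_of_isMin (fun j => hb.trans_le (hm j)) (hsuper b hbX) hbc).trans hb
  obtain ⟨a, ha⟩ := hX
  exact ((hbdry a ha).trans_eq (hconst a)).not_gt hneg

theorem eq_zero_of_mulVec_eq_zero (hL : IsIrreducibleLaplacian L) (hX : X.Nonempty)
    (hbdry : ∀ i ∈ X, x i = 0) (hharm : ∀ i ∉ X, (L *ᵥ x) i = 0) : x = 0 := by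
  funext i
  refine le_antisymm (neg_nonneg.1 ?_) ?_
  · refine hL.nonneg_of_mulVec_nonneg (x := -x) hX (fun i hi => ?_) (fun i hi => ?_) i
    · simp [hbdry i hi]
    · simp [Matrix.mulVec_neg, hharm i hi]
  · exact hL.nonneg_of_mulVec_nonneg hX (fun i hi => (hbdry i hi).ge)
      (fun i hi => (hharm i hi).ge) i

theorem eq_of_mulVec_eq_zero (hL : IsIrreducibleLaplacian L) (hx : L *ᵥ x = 0) (i j : ι) :
    x i = x j := by
  have hshift : x - x j • 1 = 0 :=
    hL.eq_zero_of_mulVec_eq_zero (Finset.singleton_nonempty j)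
      (fun i hi => by simp [Finset.mem_singleton.1 hi])
      fun i _ => by simp [Matrix.mulVec_sub, Matrix.mulVec_smul, hx, hL.mulVec_one]
  simpa [sub_eq_zero] using congrFun hshift i

end IsIrreducibleLaplacian

variable [DecidableEq ι]

/-- The Green function of `L` killed on `X`: the inverse of `L` with the rows and columns of `X`
removed, extended by zero, so that Green functions for different `X` can be compared. -/
noncomputable def green (L : Matrix ι ι ℝ) (X : Finset ι) : Matrix ι ι ℝ :=
  Matrix.of fun i j =>
    if h : i ∉ X ∧ j ∉ X then
      (L.submatrix Subtype.val Subtype.val : Matrix {u // u ∉ X} {u // u ∉ X} ℝ)⁻¹ ⟨i, h.1⟩ ⟨j, h.2⟩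
    else 0

theorem green_coe (L : Matrix ι ι ℝ) (p q : {u // u ∉ X}) :
    green L X p q =
      (L.submatrix Subtype.val Subtype.val : Matrix {u // u ∉ X} {u // u ∉ X} ℝ)⁻¹ p q :=
  dif_pos ⟨p.2, q.2⟩

theorem green_of_mem_left (L : Matrix ι ι ℝ) (hi : i ∈ X) (j : ι) : green L X i j = 0 :=
  dif_neg fun h => h.1 hi

theorem green_of_mem_right (L : Matrix ι ι ℝ) (i : ι) (hj : j ∈ X) : green L X i j = 0 :=
  dif_neg fun h => h.2 hj

theorem sum_notMem_eq_sum {f : ι → ℝ} (hf : ∀ i ∈ X, f i = 0) :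
    ∑ u : {u // u ∉ X}, f u = ∑ i, f i := by
  rw [← Fintype.sum_subtype_add_sum_subtype (· ∈ X) f,
    Finset.sum_eq_zero fun (u : {u // u ∈ X}) _ => hf u u.2, zero_add]

namespace IsIrreducibleLaplacian

theorem diagonal_mul (hL : IsIrreducibleLaplacian L) {c : ι → ℝ} (hc : ∀ i, 0 < c i) :
    IsIrreducibleLaplacian (Matrix.diagonal c * L) where
  nonpos_of_ne hij := by
    rw [Matrix.diagonal_mul]
    exact mul_nonpos_of_nonneg_of_nonpos (hc _).le (hL.nonpos_of_ne hij)
  mulVec_one := by rw [← Matrix.mulVec_mulVec, hL.mulVec_one, Matrix.mulVec_zero]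
  connected i j := by
    refine Relation.ReflTransGen.mono (fun a b hab => ?_) i j (hL.connected i j)
    rw [Matrix.diagonal_mul]
    exact mul_neg_of_pos_of_neg (hc a) hab

theorem isUnit_submatrix (hL : IsIrreducibleLaplacian L) (hX : X.Nonempty) :
    IsUnit (L.submatrix Subtype.val Subtype.val : Matrix {u // u ∉ X} {u // u ∉ X} ℝ) := by
  rw [← Matrix.mulVec_injective_iff_isUnit, ← Matrix.coe_mulVecLin,
    injective_iff_map_eq_zero]
  intro y hy
  let x : ι → ℝ := fun i => if h : i ∉ X then y ⟨i, h⟩ else 0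
  have hxX : ∀ i ∈ X, x i = 0 := fun i hi => dif_neg (not_not.2 hi)
  have hxy (u : {u // u ∉ X}) : x u = y u := dif_pos u.2
  have hx : x = 0 := hL.eq_zero_of_mulVec_eq_zero hX hxX fun i hi => by
    rw [Matrix.mulVec_apply_eq_sum, ← sum_notMem_eq_sum fun j hj => by rw [hxX j hj, mul_zero]]
    simp only [hxy]
    exact congrFun hy ⟨i, hi⟩
  ext u
  rw [← hxy, hx, Pi.zero_apply, Pi.zero_apply]

theorem mul_green_apply (hL : IsIrreducibleLaplacian L) (hX : X.Nonempty) (ha : a ∉ X) (b : ι) :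
    (L * green L X) a b = (1 : Matrix ι ι ℝ) a b := by
  by_cases hb : b ∈ X
  · rw [Matrix.one_apply_ne (ne_of_mem_of_not_mem hb ha).symm, Matrix.mul_apply]
    exact Finset.sum_eq_zero fun j _ => by rw [green_of_mem_right L j hb, mul_zero]
  · rw [Matrix.mul_apply,
      ← sum_notMem_eq_sum fun j hj => by rw [green_of_mem_left L hj, mul_zero]]
    have hinv := congrFun (congrFun (Matrix.mul_nonsing_inv _
      ((Matrix.isUnit_iff_isUnit_det _).1 (hL.isUnit_submatrix hX))) ⟨a, ha⟩) ⟨b, hb⟩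
    simpa only [Matrix.mul_apply, Matrix.one_apply, Subtype.mk.injEq, ← green_coe,
      Matrix.submatrix_apply] using hinv

theorem mulVec_green_mulVec_apply (hL : IsIrreducibleLaplacian L) (hX : X.Nonempty) (ha : a ∉ X)
    (x : ι → ℝ) : (L *ᵥ (green L X *ᵥ x)) a = x a := by
  rw [Matrix.mulVec_mulVec, Matrix.mulVec_apply_eq_sum]
  simp only [hL.mul_green_apply hX ha]
  rw [← Matrix.mulVec_apply_eq_sum, Matrix.one_mulVec]

theorem green_eq_of_mul_apply (hL : IsIrreducibleLaplacian L) (hX : X.Nonempty)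
    (hbdry : ∀ i ∈ X, ∀ j, B i j = 0)
    (hmul : ∀ a ∉ X, ∀ b, (L * B) a b = (1 : Matrix ι ι ℝ) a b) : green L X = B := by
  ext i j
  have hcol : (fun i => green L X i j - B i j) = 0 :=
    hL.eq_zero_of_mulVec_eq_zero hX
      (fun i hi => by rw [green_of_mem_left L hi, hbdry i hi, sub_zero]) fun a ha => by
        have hsub : (L * (green L X - B)) a j = 0 := by
          rw [mul_sub, Matrix.sub_apply, hL.mul_green_apply hX ha, hmul a ha, sub_self]
        exact hsub
  exact sub_eq_zero.1 (congrFun hcol i)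

theorem green_nonneg (hL : IsIrreducibleLaplacian L) (hX : X.Nonempty) (i j : ι) :
    0 ≤ green L X i j := by
  refine hL.nonneg_of_mulVec_nonneg (x := fun i => green L X i j) hX
    (fun i hi => (green_of_mem_left L hi j).ge) (fun a ha => ?_) i
  refine (?_ : (0 : ℝ) ≤ (1 : Matrix ι ι ℝ) a j).trans_eq (hL.mul_green_apply hX ha j).symm
  rw [Matrix.one_apply]
  split_ifs <;> simp

theorem green_self_pos (hL : IsIrreducibleLaplacian L) (hX : X.Nonempty) (hv : v ∉ X) :
    0 < green L X v v := by
  refine (hL.green_nonneg hX v v).lt_of_ne' fun hzero => ?_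
  have hone := hL.mul_green_apply hX hv v
  rw [Matrix.one_apply_eq, Matrix.mul_apply] at hone
  have hle : ∑ j, L v j * green L X j v ≤ 0 := Finset.sum_nonpos fun j _ => by
    rcases eq_or_ne v j with rfl | hvj
    · rw [hzero, mul_zero]
    · exact mul_nonpos_of_nonpos_of_nonneg (hL.nonpos_of_ne hvj) (hL.green_nonneg hX j v)
  linarith

theorem green_insert (hL : IsIrreducibleLaplacian L) (hX : X.Nonempty) (hv : v ∉ X) :
    green L (insert v X) = green L X -
      Matrix.vecMulVec (fun i => green L X i v) fun j => green L X v j / green L X v v := by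
  have hpos := hL.green_self_pos hX hv
  refine hL.green_eq_of_mul_apply (Finset.insert_nonempty v X) (fun i hi j => ?_) fun a ha b => ?_
  · rw [Matrix.sub_apply, Matrix.vecMulVec_apply]
    rcases Finset.mem_insert.1 hi with rfl | hi
    · rw [mul_div_cancel₀ _ hpos.ne', sub_self]
    · simp only [green_of_mem_left L hi, zero_mul, sub_zero]
  · obtain ⟨hav, haX⟩ := not_or.1 (mt Finset.mem_insert.2 ha)
    have hcol : (L *ᵥ fun i => green L X i v) a = 0 :=
      (hL.mul_green_apply hX haX v).trans (Matrix.one_apply_ne hav)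
    rw [mul_sub, Matrix.mul_vecMulVec, Matrix.sub_apply, Matrix.vecMulVec_apply, hcol, zero_mul,
      sub_zero, hL.mul_green_apply hX haX]

theorem green_antitone (hL : IsIrreducibleLaplacian L) (hX : X.Nonempty) (hXY : X ⊆ Y)
    (i j : ι) : green L Y i j ≤ green L X i j := by
  refine sub_nonneg.1 (hL.nonneg_of_mulVec_nonneg (x := fun i => green L X i j - green L Y i j)
    (hX.mono hXY) (fun i hi => ?_) (fun a ha => ?_) i)
  · rw [green_of_mem_left L hi, sub_zero]
    exact hL.green_nonneg hX i j
  · have hharm : (L * (green L X - green L Y)) a j = 0 := by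
      rw [mul_sub, Matrix.sub_apply, hL.mul_green_apply hX fun h => ha (hXY h),
        hL.mul_green_apply (hX.mono hXY) ha, sub_self]
    exact hharm.ge

-- `green L X i v / green L X v v` is the probability that the walk from `i` hits `v` before `X`.
theorem green_div_green_self_antitone (hL : IsIrreducibleLaplacian L) (hX : X.Nonempty)
    (hXY : X ⊆ Y) (hv : v ∉ Y) (i : ι) :
    green L Y i v / green L Y v v ≤ green L X i v / green L X v v := by
  have hY := hX.mono hXY
  have hvX : v ∉ X := fun h => hv (hXY h)
  refine sub_nonneg.1 (hL.nonneg_of_mulVec_nonneg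
    (x := fun i => green L X i v / green L X v v - green L Y i v / green L Y v v)
    (Finset.insert_nonempty v Y) (fun i hi => ?_) (fun a ha => ?_) i)
  · rcases Finset.mem_insert.1 hi with rfl | hi
    · rw [div_self (hL.green_self_pos hX hvX).ne', div_self (hL.green_self_pos hY hv).ne', sub_self]
    · rw [green_of_mem_left L hi, zero_div, sub_zero]
      exact div_nonneg (hL.green_nonneg hX i v) (hL.green_nonneg hX v v)
  · obtain ⟨hav, haY⟩ := not_or.1 (mt Finset.mem_insert.2 ha)
    have hharm : (L * ((green L X v v)⁻¹ • green L X - (green L Y v v)⁻¹ • green L Y)) a v = 0 := by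
      rw [mul_sub, Matrix.mul_smul, Matrix.mul_smul, Matrix.sub_apply, Matrix.smul_apply,
        Matrix.smul_apply, hL.mul_green_apply hX fun h => haY (hXY h), hL.mul_green_apply hY haY,
        Matrix.one_apply_ne hav, smul_zero, smul_zero, sub_self]
    simp only [div_eq_inv_mul]
    exact hharm.ge

theorem decrement_trace_green (hL : IsIrreducibleLaplacian L) (hX : X.Nonempty) (hv : v ∉ X) :
    decrement (fun X => (green L X).trace) X v =
      (green L X * green L X) v v / green L X v v := by
  rw [decrement, hL.green_insert hX hv, Matrix.trace_sub, sub_sub_cancel, Matrix.trace_vecMulVec,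
    Matrix.mul_apply, dotProduct, Finset.sum_div]
  exact Finset.sum_congr rfl fun i _ => by ring

theorem isAntitoneSupermodular_trace_green (hL : IsIrreducibleLaplacian L) :
    IsAntitoneSupermodular fun X => (green L X).trace where
  le_of_subset hX hXY := Finset.sum_le_sum fun i _ => hL.green_antitone hX hXY i i
  decrement_le {X Y v} hX hXY hv := by
    have hY := hX.mono hXY
    rw [hL.decrement_trace_green hX fun h => hv (hXY h), hL.decrement_trace_green hY hv]
    simp only [Matrix.mul_apply, Finset.sum_div, mul_div_assoc]
    exact Finset.sum_le_sum fun i _ =>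
      mul_le_mul (hL.green_antitone hX hXY v i) (hL.green_div_green_self_antitone hX hXY hv i)
        (div_nonneg (hL.green_nonneg hY i v) (hL.green_nonneg hY v v)) (hL.green_nonneg hX v i)

end IsIrreducibleLaplacian

end IrreducibleLaplacian

section PseudoinverseOfLaplacian

open scoped Matrix

variable {n : ℕ} {L : Matrix (Fin n) (Fin n) ℝ} {x : Fin n → ℝ}

/-- The matrix of the orthogonal projection of `ℝⁿ` onto the constant vectors. -/
noncomputable def averaging (n : ℕ) : Matrix (Fin n) (Fin n) ℝ :=
  (n : ℝ)⁻¹ • Matrix.vecMulVec 1 1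

theorem averaging_apply (i j : Fin n) : averaging n i j = (n : ℝ)⁻¹ := by
  simp [averaging]

theorem averaging_transpose : (averaging n)ᵀ = averaging n := by
  rw [averaging, Matrix.transpose_smul, Matrix.transpose_vecMulVec]

theorem mul_averaging (hL : L *ᵥ 1 = 0) : L * averaging n = 0 := by
  rw [averaging, Matrix.mul_smul, Matrix.mul_vecMulVec, hL, Matrix.zero_vecMulVec, smul_zero]

theorem averaging_mul (hL : 1 ᵥ* L = 0) : averaging n * L = 0 := by
  rw [averaging, Matrix.smul_mul, Matrix.vecMulVec_mul, hL, Matrix.vecMulVec_zero, smul_zero]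

theorem averaging_mulVec_of_const (hx : ∀ i j, x i = x j) : averaging n *ᵥ x = x := by
  ext i
  have hn : (n : ℝ) ≠ 0 := Nat.cast_ne_zero.2 i.pos.ne'
  simp only [Matrix.mulVec_apply_eq_sum, averaging_apply, hx _ i]
  simp [hn]

theorem averaging_mul_self : averaging n * averaging n = averaging n := by
  ext i j
  exact congrFun (averaging_mulVec_of_const (x := fun l => averaging n l j) fun _ _ => by
    simp only [averaging_apply]) i

namespace IsIrreducibleLaplacian

theorem isUnit_add_averaging (hL : IsIrreducibleLaplacian L) (hcol : 1 ᵥ* L = 0) :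
    IsUnit (L + averaging n) := by
  rw [← Matrix.mulVec_injective_iff_isUnit, ← Matrix.coe_mulVecLin, injective_iff_map_eq_zero]
  intro x hx
  rw [Matrix.mulVecLin_apply] at hx
  have havg : averaging n *ᵥ x = 0 := by
    simpa only [Matrix.mulVec_mulVec, mul_add, averaging_mul hcol, zero_add, averaging_mul_self,
      Matrix.mulVec_zero] using congrArg (averaging n *ᵥ ·) hx
  have hharm : L *ᵥ x = 0 := by rwa [Matrix.add_mulVec, havg, add_zero] at hx
  rw [← averaging_mulVec_of_const (hL.eq_of_mulVec_eq_zero hharm), havg]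

theorem isMoorePenrose_pinv (hL : IsIrreducibleLaplacian L) (hcol : 1 ᵥ* L = 0) :
    IsMoorePenrose L (pinv L) := by
  have hB := isMoorePenrose_inv_add_sub averaging_mul_self averaging_transpose
    (mul_averaging hL.mulVec_one) (averaging_mul hcol) (hL.isUnit_add_averaging hcol)
  rwa [hB.pinv_eq]

theorem mul_pinv (hL : IsIrreducibleLaplacian L) (hcol : 1 ᵥ* L = 0) :
    L * pinv L = 1 - averaging n := by
  have hunit := hL.isUnit_add_averaging hcol
  have hLJ := mul_averaging hL.mulVec_one
  rw [(isMoorePenrose_inv_add_sub averaging_mul_self averaging_transpose hLJ (averaging_mul hcol)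
    hunit).pinv_eq, mul_inv_add_sub_eq averaging_mul_self hLJ (averaging_mul hcol) hunit]

theorem sum_pinv_row (hL : IsIrreducibleLaplacian L) (hcol : 1 ᵥ* L = 0) (i : Fin n) :
    ∑ j, pinv L i j = 0 := by
  simpa [Matrix.mulVec_apply_eq_sum] using
    congrFun ((hL.isMoorePenrose_pinv hcol).mulVec_eq_zero hcol) i

theorem sum_pinv_col (hL : IsIrreducibleLaplacian L) (hcol : 1 ᵥ* L = 0) (j : Fin n) :
    ∑ i, pinv L i j = 0 := by
  simpa [Matrix.vecMul, dotProduct] using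
    congrFun ((hL.isMoorePenrose_pinv hcol).vecMul_eq_zero hL.mulVec_one) j

theorem green_singleton (hL : IsIrreducibleLaplacian L) (hcol : 1 ᵥ* L = 0) (v i j : Fin n) :
    green L {v} i j = pinv L i j - pinv L i v - pinv L v j + pinv L v v := by
  have hrow (a : Fin n) : ∑ l, L a l = 0 := by
    simpa [Matrix.mulVec_apply_eq_sum] using congrFun hL.mulVec_one a
  have hmul (a b : Fin n) : ∑ l, L a l * pinv L l b = (1 : Matrix _ _ ℝ) a b - (n : ℝ)⁻¹ := by
    rw [← Matrix.mul_apply, hL.mul_pinv hcol, Matrix.sub_apply, averaging_apply]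
  have hgreen : green L {v} =
      Matrix.of fun i j => pinv L i j - pinv L i v - pinv L v j + pinv L v v := by
    refine hL.green_eq_of_mul_apply (Finset.singleton_nonempty v) (fun i hi j => ?_)
      fun a ha b => ?_
    · rw [Finset.mem_singleton.1 hi, Matrix.of_apply]
      ring
    · have hav : a ≠ v := mt Finset.mem_singleton.2 ha
      simp only [Matrix.mul_apply, Matrix.of_apply, mul_sub, mul_add, Finset.sum_sub_distrib,
        Finset.sum_add_distrib, ← Finset.sum_mul, hrow, hmul, Matrix.one_apply_ne hav]
      ring
  rw [hgreen, Matrix.of_apply]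

theorem trace_green_singleton (hL : IsIrreducibleLaplacian L) (hcol : 1 ᵥ* L = 0) (v : Fin n) :
    (green L {v}).trace = n * pinv L v v + (pinv L).trace := by
  simp only [Matrix.trace, Matrix.diag_apply, hL.green_singleton hcol, Finset.sum_sub_distrib,
    Finset.sum_add_distrib, hL.sum_pinv_row hcol, hL.sum_pinv_col hcol, Finset.sum_const,
    Finset.card_univ, Fintype.card_fin, nsmul_eq_mul]
  ring

theorem sum_green_singleton_self (hL : IsIrreducibleLaplacian L) (hcol : 1 ᵥ* L = 0) (v : Fin n) :
    ∑ j, green L {j} v v = n * pinv L v v + (pinv L).trace := by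
  simp only [Matrix.trace, Matrix.diag_apply, hL.green_singleton hcol, Finset.sum_sub_distrib,
    Finset.sum_add_distrib, hL.sum_pinv_row hcol, hL.sum_pinv_col hcol, Finset.sum_const,
    Finset.card_univ, Fintype.card_fin, nsmul_eq_mul]
  ring

end IsIrreducibleLaplacian

end PseudoinverseOfLaplacian

namespace Exact

open scoped Matrix

variable {n k i : ℕ} {L : Matrix (Fin n) (Fin n) ℝ} {X Y : Finset (Fin n)}
  {M : Matrix {u // u ∉ X} {u // u ∉ X} ℝ}

theorem State.card_eq (h : State L i X M) : X.card = i := by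
  induction h with
  | init v _ => exact Finset.card_singleton v
  | step _ v _ ih => rw [Finset.card_insert_of_notMem v.2, ih]

theorem State.nonempty (h : State L i X M) : X.Nonempty := by
  cases h with
  | init v _ => exact Finset.singleton_nonempty v
  | step _ v _ => exact Finset.insert_nonempty _ _

theorem exists_state (L : Matrix (Fin n) (Fin n) ℝ) (hi : 1 ≤ i) (hin : i ≤ n) :
    ∃ X M, State L i X M := by
  induction i, hi using Nat.le_induction with
  | base =>
    have : Nonempty (Fin n) := ⟨⟨0, hin⟩⟩
    obtain ⟨v, hv⟩ := Finite.exists_min fun v => n * pinv L v v + (pinv L).trace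
    exact ⟨_, _, .init v hv⟩
  | succ i _ ih =>
    obtain ⟨X, M, h⟩ := ih (Nat.le_of_succ_le hin)
    obtain ⟨a, ha⟩ : ∃ a, a ∉ X := by
      by_contra! hall
      have hcard := h.card_eq
      rw [Finset.eq_univ_of_forall hall, Finset.card_univ, Fintype.card_fin] at hcard
      omega
    have : Nonempty {u // u ∉ X} := ⟨⟨a, ha⟩⟩
    obtain ⟨v, hv⟩ := Finite.exists_max (gain M)
    exact ⟨_, _, .step h v hv⟩

theorem inv_removed_apply (L : Matrix (Fin n) (Fin n) ℝ) (p q : {u // u ∉ X}) :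
    (removed L X)⁻¹ p q = green L X p q :=
  (green_coe L p q).symm

theorem update_inv_removed (hL : IsIrreducibleLaplacian L) (hX : X.Nonempty)
    (v : {u // u ∉ X}) : update (removed L X)⁻¹ v = (removed L (insert v.1 X))⁻¹ := by
  ext p q
  simp only [update, Matrix.of_apply, inv_removed_apply, hL.green_insert hX v.2, Matrix.sub_apply,
    Matrix.vecMulVec_apply, mul_div_assoc]

theorem gain_inv_removed (hL : IsIrreducibleLaplacian L) (hX : X.Nonempty) (v : {u // u ∉ X}) :
    gain (removed L X)⁻¹ v = decrement (fun X => (green L X).trace) X v := by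
  rw [hL.decrement_trace_green hX v.2, Matrix.mul_apply,
    ← sum_notMem_eq_sum fun j hj => by rw [green_of_mem_left L hj, mul_zero]]
  simp only [gain, Matrix.mul_apply, inv_removed_apply]

namespace State

theorem eq_inv_removed (hL : IsIrreducibleLaplacian L) (h : State L i X M) :
    M = (removed L X)⁻¹ := by
  induction h with
  | init v _ => rfl
  | step h v _ ih => rw [ih, update_inv_removed hL h.nonempty]

theorem trace_green_le (hL : IsIrreducibleLaplacian L) (hcol : 1 ᵥ* L = 0) (h : State L i X M)
    (v : Fin n) : (green L X).trace ≤ (green L {v}).trace := by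
  induction h with
  | init u hu =>
    rw [hL.trace_green_singleton hcol, hL.trace_green_singleton hcol]
    exact hu v
  | step h u _ ih =>
    exact (hL.isAntitoneSupermodular_trace_green.le_of_subset h.nonempty
      (Finset.subset_insert _ _)).trans ih

theorem trace_green_sub_le (hL : IsIrreducibleLaplacian L) (hcol : 1 ᵥ* L = 0) (h : State L i X M)
    (v : Fin n) (hY : Y.Nonempty) (hYk : Y.card ≤ k) :
    (green L X).trace - (green L Y).trace ≤
      (1 - 1 / (k : ℝ)) ^ (i - 1) * ((green L {v}).trace - (green L Y).trace) := by
  have hk : (1 : ℝ) ≤ k := Nat.one_le_cast.2 (hY.card_pos.trans_le hYk)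
  have hfactor : 0 ≤ 1 - 1 / (k : ℝ) := sub_nonneg.2 (div_le_one_of_le₀ hk (by linarith))
  induction h with
  | init u hu =>
    simpa using (State.init u hu).trace_green_le hL hcol v
  | @step i X M h u hu ih =>
    have hi : 1 ≤ i := h.card_eq ▸ h.nonempty.card_pos
    have hgreedy : ∀ w ∉ X, decrement (fun X => (green L X).trace) X w ≤
        decrement (fun X => (green L X).trace) X u := fun w hw => by
      rw [← gain_inv_removed hL h.nonempty u, ← gain_inv_removed hL h.nonempty ⟨w, hw⟩,
        ← h.eq_inv_removed hL]
      exact hu _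
    calc (green L (insert u.1 X)).trace - (green L Y).trace
        ≤ (1 - 1 / (k : ℝ)) * ((green L X).trace - (green L Y).trace) :=
          hL.isAntitoneSupermodular_trace_green.greedy_step h.nonempty hY hYk hgreedy
      _ ≤ (1 - 1 / (k : ℝ)) * ((1 - 1 / (k : ℝ)) ^ (i - 1) *
            ((green L {v}).trace - (green L Y).trace)) := mul_le_mul_of_nonneg_left ih hfactor
      _ = (1 - 1 / (k : ℝ)) ^ (i + 1 - 1) * ((green L {v}).trace - (green L Y).trace) := by
          rw [← mul_assoc, ← pow_succ', Nat.sub_add_cancel hi, Nat.add_sub_cancel]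

end State

end Exact

section RowStochastic

open scoped Matrix

variable {ι : Type*} [Fintype ι] {M : Matrix ι ι ℝ} {p : ι → ℝ}

theorem pos_of_vecMul_eq (hM : ∀ i j, 0 ≤ M i j)
    (hconn : ∀ i j, Relation.ReflTransGen (fun a b => 0 < M a b) i j)
    (hp : p ∈ stdSimplex ℝ ι) (hpM : p ᵥ* M = p) (i : ι) : 0 < p i := by
  obtain ⟨a, -, ha⟩ : ∃ a ∈ Finset.univ, 0 < p a :=
    Finset.exists_lt_of_sum_lt (f := fun _ => (0 : ℝ)) (by simp [hp.2])
  induction hconn a i with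
  | refl => exact ha
  | @tail b c _ hbc hb =>
    rw [← hpM]
    exact Finset.sum_pos' (fun i _ => mul_nonneg (hp.1 i) (hM i c))
      ⟨b, Finset.mem_univ b, mul_pos hb hbc⟩

variable [DecidableEq ι]

theorem exists_vecMul_eq_of_mem_rowStochastic [Nonempty ι] (hM : M ∈ Matrix.rowStochastic ℝ ι) :
    ∃ x ≠ 0, x ᵥ* M = x := by
  have hdet : (1 - M).det = 0 := by
    refine Matrix.exists_mulVec_eq_zero_iff.1 ⟨1, one_ne_zero, ?_⟩
    rw [Matrix.sub_mulVec, Matrix.one_mulVec, Matrix.one_vecMul_of_mem_rowStochastic hM, sub_self]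
  obtain ⟨x, hx0, hx⟩ := Matrix.exists_vecMul_eq_zero_iff.2 hdet
  rw [Matrix.vecMul_sub, Matrix.vecMul_one, sub_eq_zero] at hx
  exact ⟨x, hx0, hx.symm⟩

-- `|x| ≤ |x| M` entrywise, and both sides have the same sum.
theorem abs_vecMul_eq_of_vecMul_eq (hM : M ∈ Matrix.rowStochastic ℝ ι) {x : ι → ℝ}
    (hx : x ᵥ* M = x) : |x| ᵥ* M = |x| := by
  have hle : ∀ j ∈ Finset.univ, |x| j ≤ (|x| ᵥ* M) j := fun j _ =>
    calc |x| j = |∑ i, x i * M i j| := congrArg abs (congrFun hx j).symm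
      _ ≤ ∑ i, |x i * M i j| := Finset.abs_sum_le_sum_abs _ _
      _ = (|x| ᵥ* M) j := Finset.sum_congr rfl fun i _ => by
          rw [abs_mul, abs_of_nonneg (Matrix.nonneg_of_mem_rowStochastic hM), Pi.abs_apply]
  have hsum : ∑ j, |x| j = ∑ j, (|x| ᵥ* M) j := by
    rw [← dotProduct_one, ← dotProduct_one, ← Matrix.dotProduct_mulVec,
      Matrix.one_vecMul_of_mem_rowStochastic hM]
  funext j
  exact ((Finset.sum_eq_sum_iff_of_le hle).1 hsum j (Finset.mem_univ j)).symm

theorem exists_mem_stdSimplex_vecMul_eq [Nonempty ι] (hM : M ∈ Matrix.rowStochastic ℝ ι) :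
    ∃ p, p ∈ stdSimplex ℝ ι ∧ p ᵥ* M = p := by
  obtain ⟨x, hx0, hx⟩ := exists_vecMul_eq_of_mem_rowStochastic hM
  obtain ⟨i, hi⟩ := Function.ne_iff.1 hx0
  have hpos : 0 < ∑ j, |x j| :=
    Finset.sum_pos' (fun _ _ => abs_nonneg _) ⟨i, Finset.mem_univ _, abs_pos.2 hi⟩
  refine ⟨(∑ j, |x j|)⁻¹ • |x|, ⟨fun j => ?_, ?_⟩, ?_⟩
  · exact mul_nonneg (inv_nonneg.2 hpos.le) (abs_nonneg _)
  · simp only [Pi.smul_apply, Pi.abs_apply, smul_eq_mul, ← Finset.mul_sum]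
    exact inv_mul_cancel₀ hpos.ne'
  · rw [Matrix.smul_vecMul, abs_vecMul_eq_of_vecMul_eq hM hx]

theorem isIrreducibleLaplacian_one_sub (hM : M ∈ Matrix.rowStochastic ℝ ι)
    (hconn : ∀ i j, Relation.ReflTransGen (fun a b => 0 < M a b) i j) :
    IsIrreducibleLaplacian (1 - M) where
  nonpos_of_ne hij := by
    rw [Matrix.sub_apply, Matrix.one_apply_ne hij, zero_sub, neg_nonpos]
    exact Matrix.nonneg_of_mem_rowStochastic hM
  mulVec_one := by
    rw [Matrix.sub_mulVec, Matrix.one_mulVec, Matrix.one_vecMul_of_mem_rowStochastic hM, sub_self]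
  connected i j := by
    refine Relation.reflTransGen_closed (fun a b hab => ?_) i j (hconn i j)
    rcases eq_or_ne a b with rfl | hne
    · exact .refl
    · refine .single ?_
      rw [Matrix.sub_apply, Matrix.one_apply_ne hne, zero_sub, neg_neg_iff_pos]
      exact hab

end RowStochastic

namespace WeightedDigraph

open scoped Matrix

variable {n : ℕ} {G : WeightedDigraph n}

theorem StronglyConnected.deg_pos [Nontrivial (Fin n)] (hG : G.StronglyConnected) (i : Fin n) :
    0 < G.deg i := by
  obtain ⟨j, hj⟩ := exists_ne i
  rcases (hG i j).cases_head with h | ⟨c, hc, -⟩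
  · exact absurd h.symm hj
  · exact Finset.sum_pos' (fun j _ => G.nonneg i j) ⟨c, Finset.mem_univ c, hc⟩

theorem P_nonneg (i j : Fin n) : 0 ≤ G.P i j :=
  div_nonneg (G.nonneg i j) (Finset.sum_nonneg fun j _ => G.nonneg i j)

namespace StronglyConnected

variable [Nontrivial (Fin n)]

theorem vol_pos (hG : G.StronglyConnected) : 0 < G.vol :=
  Finset.sum_pos (fun i _ => hG.deg_pos i) Finset.univ_nonempty

theorem P_mem_rowStochastic (hG : G.StronglyConnected) : G.P ∈ Matrix.rowStochastic ℝ (Fin n) :=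
  Matrix.mem_rowStochastic_iff_sum.2 ⟨fun i j => P_nonneg i j, fun i => by
    simp only [P, Matrix.of_apply, ← Finset.sum_div]
    exact div_self (hG.deg_pos i).ne'⟩

theorem P_connected (hG : G.StronglyConnected) (i j : Fin n) :
    Relation.ReflTransGen (fun a b => 0 < G.P a b) i j :=
  Relation.ReflTransGen.mono (fun a _ hab => div_pos hab (hG.deg_pos a)) i j (hG i j)

theorem isIrreducibleLaplacian_one_sub_P (hG : G.StronglyConnected) :
    IsIrreducibleLaplacian (1 - G.P) :=
  isIrreducibleLaplacian_one_sub hG.P_mem_rowStochastic hG.P_connected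

theorem stationary_spec (hG : G.StronglyConnected) :
    G.stationary ∈ stdSimplex ℝ (Fin n) ∧ G.stationary ᵥ* G.P = G.stationary := by
  have h := exists_mem_stdSimplex_vecMul_eq hG.P_mem_rowStochastic
  rw [stationary, dif_pos h]
  exact h.choose_spec

theorem stationary_pos (hG : G.StronglyConnected) (i : Fin n) : 0 < G.stationary i :=
  pos_of_vecMul_eq P_nonneg hG.P_connected hG.stationary_spec.1 hG.stationary_spec.2 i

end StronglyConnected

theorem laplacian_mulVec_apply (x : Fin n → ℝ) (i : Fin n) :
    (G.laplacian *ᵥ x) i = G.vol * G.stationary i * (x i - (G.P *ᵥ x) i) := by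
  rw [laplacian, Matrix.smul_mulVec, ← Matrix.mulVec_mulVec, Pi.smul_apply,
    Matrix.mulVec_diagonal, Matrix.sub_mulVec, Matrix.one_mulVec, Pi.sub_apply, smul_eq_mul,
    mul_assoc]

variable [Nontrivial (Fin n)]

theorem StronglyConnected.isIrreducibleLaplacian_laplacian (hG : G.StronglyConnected) :
    IsIrreducibleLaplacian G.laplacian := by
  have hlap : G.laplacian = Matrix.diagonal (G.vol • G.stationary) * (1 - G.P) := by
    rw [laplacian, Matrix.diagonal_smul, Matrix.smul_mul]
  rw [hlap]
  exact hG.isIrreducibleLaplacian_one_sub_P.diagonal_mul fun i =>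
    mul_pos hG.vol_pos (hG.stationary_pos i)

theorem StronglyConnected.one_vecMul_laplacian (hG : G.StronglyConnected) :
    1 ᵥ* G.laplacian = 0 := by
  have hdiag : 1 ᵥ* Matrix.diagonal G.stationary = G.stationary := by
    ext i
    rw [Matrix.vecMul_diagonal, Pi.one_apply, one_mul]
  rw [laplacian, Matrix.vecMul_smul, ← Matrix.vecMul_vecMul, hdiag, Matrix.vecMul_sub,
    Matrix.vecMul_one, hG.stationary_spec.2, sub_self, smul_zero]

end WeightedDigraph

namespace WeightedDigraph

open scoped Matrix

variable {n : ℕ} {G : WeightedDigraph n} {j l : Fin n} {Z : Finset (Fin n)} {t : ℕ}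

instance (i : Fin n) : IsProbabilityMeasure (G.walkLaw i) := by
  unfold walkLaw
  infer_instance

theorem map_eval_zero_walkLaw (i : Fin n) :
    (G.walkLaw i).map (fun w => w 0) = Measure.dirac i := by
  have hrestrict : (G.walkLaw i).map (Preorder.frestrictLe 0) =
      (Measure.dirac i).map (MeasurableEquiv.piUnique fun _ : Finset.Iic 0 => Fin n).symm := by
    unfold walkLaw Kernel.trajMeasure
    rw [Measure.map_comp _ _ (by fun_prop), Kernel.traj_map_frestrictLe, Kernel.partialTraj_self,
      Measure.id_comp]
  have heval : (fun w : ℕ → Fin n => w 0) =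
      (MeasurableEquiv.piUnique fun _ : Finset.Iic 0 => Fin n) ∘ Preorder.frestrictLe 0 := rfl
  rw [heval, ← Measure.map_map (by fun_prop) (by fun_prop), hrestrict,
    MeasurableEquiv.map_map_symm]

theorem stepKernel_singleton (hl : G.deg l ≠ 0) (j : Fin n) :
    G.stepKernel l {j} = ENNReal.ofReal (G.P l j) := by
  change (G.stepLaw l).toMeasure {j} = _
  rw [PMF.toMeasure_apply_singleton _ _ (measurableSet_singleton j), stepLaw, dif_pos hl]
  rfl

theorem walkLaw_real_markov (hl : G.deg l ≠ 0) (i j : Fin n) (S : Set (Finset.Iic t → Fin n)) :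
    (G.walkLaw i).real ({w | Preorder.frestrictLe t w ∈ S ∧ w t = l} ∩ {w | w (t + 1) = j}) =
      (G.walkLaw i).real {w | Preorder.frestrictLe t w ∈ S ∧ w t = l} * G.P l j := by
  let T : Set (Finset.Iic t → Fin n) := S ∩ {x | x ⟨t, Finset.mem_Iic.2 le_rfl⟩ = l}
  have hT : MeasurableSet T := .of_discrete
  have hstep : ∀ x ∈ T, G.historyKernel t x {j} = ENNReal.ofReal (G.P l j) := fun x hx => by
    change G.stepKernel (x ⟨t, _⟩) {j} = _
    rw [hx.2, stepKernel_singleton hl]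
  have hjoint := congrArg (fun μ => μ (T ×ˢ ({j} : Set (Fin n))))
    (Kernel.map_frestrictLe_trajMeasure_compProd_eq_map_trajMeasure
      (X := fun _ => Fin n) (κ := G.historyKernel) (μ₀ := Measure.dirac i) (a := t))
  beta_reduce at hjoint
  rw [Measure.compProd_apply_prod hT (measurableSet_singleton j),
    Measure.map_apply (by fun_prop) (hT.prod (measurableSet_singleton j)),
    setLIntegral_congr_fun hT hstep, setLIntegral_const, Measure.map_apply (by fun_prop) hT]
    at hjoint
  have hreal := congrArg ENNReal.toReal hjoint
  rw [ENNReal.toReal_mul, ENNReal.toReal_ofReal (P_nonneg l j), mul_comm] at hreal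
  exact hreal.symm

/-- The event that the walk avoids `Z` at the times `1, …, t`; the starting point is exempt, so that
returns to it can be described. -/
def avoids (Z : Finset (Fin n)) (t : ℕ) : Set (ℕ → Fin n) :=
  {w | ∀ s, 1 ≤ s → s ≤ t → w s ∉ Z}

/-- The occupation vector at time `t` of the walk from `i` killed on `Z`: its entry at `l` is the
probability that the walk is at `l` at time `t` and has avoided `Z` at the times `1, …, t`. -/
noncomputable def occupation (G : WeightedDigraph n) (i : Fin n) (Z : Finset (Fin n)) (t : ℕ)
    (l : Fin n) : ℝ :=
  (G.walkLaw i).real (avoids Z t ∩ {w | w t = l})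

theorem measurableSet_eval_mem (t : ℕ) (s : Set (Fin n)) :
    MeasurableSet {w : ℕ → Fin n | w t ∈ s} :=
  measurable_pi_apply t (MeasurableSet.of_discrete (s := s))

theorem measurableSet_avoids (Z : Finset (Fin n)) (t : ℕ) : MeasurableSet (avoids Z t) := by
  simp only [avoids, Set.ofPred_forall]
  exact .iInter fun s => .iInter fun _ => .iInter fun _ => measurableSet_eval_mem s {a | a ∉ Z}

theorem avoids_succ (Z : Finset (Fin n)) (t : ℕ) :
    avoids Z (t + 1) = avoids Z t ∩ {w | w (t + 1) ∉ Z} := by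
  ext w
  refine ⟨fun h => ⟨fun s hs hst => h s hs (hst.trans t.le_succ), h (t + 1) t.succ_pos le_rfl⟩,
    fun h s hs hst => ?_⟩
  rcases hst.lt_or_eq with hst | rfl
  · exact h.1 s hs (Nat.lt_succ_iff.1 hst)
  · exact h.2

theorem measureReal_inter_eval_mem_eq_sum (μ : Measure (ℕ → Fin n)) [IsFiniteMeasure μ]
    (A : Set (ℕ → Fin n)) (t : ℕ) (s : Finset (Fin n)) :
    μ.real (A ∩ {w | w t ∈ s}) = ∑ l ∈ s, μ.real (A ∩ {w | w t = l}) := by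
  have hrestrict (B : Set (Fin n)) :
      μ.real (A ∩ {w | w t ∈ B}) = (μ.restrict A).real ((fun w => w t) ⁻¹' B) := by
    rw [measureReal_restrict_apply (measurable_pi_apply t .of_discrete), Set.inter_comm]
    rfl
  refine (hrestrict s).trans ((sum_measureReal_preimage_singleton s fun l _ =>
    measurable_pi_apply t .of_discrete).symm.trans (Finset.sum_congr rfl fun l _ => ?_))
  exact (hrestrict {l}).symm

theorem occupation_nonneg (i : Fin n) (Z : Finset (Fin n)) (t : ℕ) (l : Fin n) :
    0 ≤ G.occupation i Z t l :=
  measureReal_nonneg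

theorem occupation_zero (i : Fin n) (Z : Finset (Fin n)) :
    G.occupation i Z 0 = Pi.single i 1 := by
  ext l
  have havoids : avoids Z 0 = Set.univ :=
    Set.eq_univ_of_forall fun w s hs hs0 => absurd (hs.trans hs0) Nat.one_pos.not_ge
  have hmap : (G.walkLaw i).real {w | w 0 = l} = (Measure.dirac i).real {l} := by
    rw [← map_eval_zero_walkLaw, map_measureReal_apply (by fun_prop) (measurableSet_singleton l)]
    rfl
  rw [occupation, havoids, Set.univ_inter, hmap, measureReal_def, Measure.dirac_apply,
    Pi.single_apply]
  by_cases hil : i = l <;> simp [hil, eq_comm]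

theorem walkLaw_real_avoids_inter_succ (hdeg : ∀ l, G.deg l ≠ 0) (i : Fin n)
    (Z : Finset (Fin n)) (t : ℕ) (j : Fin n) :
    (G.walkLaw i).real (avoids Z t ∩ {w | w (t + 1) = j}) = (G.occupation i Z t ᵥ* G.P) j := by
  let S : Set (Finset.Iic t → Fin n) := {x | ∀ s : Finset.Iic t, 1 ≤ s.1 → x s ∉ Z}
  have havoids (l : Fin n) : avoids Z t ∩ {w | w t = l} =
      {w | Preorder.frestrictLe (π := fun _ => Fin n) t w ∈ S ∧ w t = l} := by
    ext w
    exact and_congr_left fun _ => ⟨fun h s hs => h s hs (Finset.mem_Iic.1 s.2),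
      fun h s hs hst => h ⟨s, Finset.mem_Iic.2 hst⟩ hs⟩
  have hsplit := measureReal_inter_eval_mem_eq_sum (G.walkLaw i)
    (avoids Z t ∩ {w | w (t + 1) = j}) t Finset.univ
  simp only [Finset.mem_univ, Set.ofPred_true, Set.inter_univ] at hsplit
  rw [hsplit]
  refine Finset.sum_congr rfl fun l _ => ?_
  rw [Set.inter_right_comm, occupation, havoids, walkLaw_real_markov (hdeg l)]

theorem occupation_succ_of_mem (i : Fin n) (t : ℕ) (hj : j ∈ Z) :
    G.occupation i Z (t + 1) j = 0 := by
  have hempty : avoids Z (t + 1) ∩ {w | w (t + 1) = j} = ∅ :=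
    Set.eq_empty_of_forall_notMem fun w ⟨hw, hwj⟩ =>
      hw (t + 1) t.succ_pos le_rfl (Set.mem_ofPred_eq ▸ hwj ▸ hj)
  rw [occupation, hempty, measureReal_empty]

theorem occupation_succ_of_notMem (hdeg : ∀ l, G.deg l ≠ 0) (i : Fin n) (t : ℕ) (hj : j ∉ Z) :
    G.occupation i Z (t + 1) j = (G.occupation i Z t ᵥ* G.P) j := by
  have havoids : avoids Z (t + 1) ∩ {w | w (t + 1) = j} = avoids Z t ∩ {w | w (t + 1) = j} := by
    have hsub : {w : ℕ → Fin n | w (t + 1) = j} ⊆ {w | w (t + 1) ∉ Z} :=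
      fun w (hw : w (t + 1) = j) => show w (t + 1) ∉ Z from hw ▸ hj
    rw [avoids_succ, Set.inter_assoc, Set.inter_eq_right.2 hsub]
  rw [occupation, havoids, walkLaw_real_avoids_inter_succ hdeg]

theorem occupation_succ_dotProduct (hdeg : ∀ l, G.deg l ≠ 0) (i : Fin n) (t : ℕ) {u : Fin n → ℝ}
    (hu : ∀ j ∈ Z, u j = 0) :
    G.occupation i Z (t + 1) ⬝ᵥ u = G.occupation i Z t ⬝ᵥ (G.P *ᵥ u) := by
  rw [Matrix.dotProduct_mulVec]
  refine Finset.sum_congr rfl fun j _ => ?_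
  by_cases hj : j ∈ Z
  · rw [hu j hj, mul_zero, mul_zero]
  · rw [occupation_succ_of_notMem hdeg i t hj]

theorem occupation_succ_dotProduct_congr (i : Fin n) (t : ℕ) {u v : Fin n → ℝ}
    (huv : ∀ j ∉ Z, u j = v j) :
    G.occupation i Z (t + 1) ⬝ᵥ u = G.occupation i Z (t + 1) ⬝ᵥ v := by
  refine Finset.sum_congr rfl fun j _ => ?_
  by_cases hj : j ∈ Z
  · rw [occupation_succ_of_mem i t hj, zero_mul, zero_mul]
  · rw [huv j hj]

variable [Nontrivial (Fin n)]

theorem StronglyConnected.exists_nonneg_mulVec_P_eq_sub_one (hG : G.StronglyConnected)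
    (hZ : Z.Nonempty) :
    ∃ u : Fin n → ℝ, (∀ j, 0 ≤ u j) ∧ (∀ j ∈ Z, u j = 0) ∧ ∀ j ∉ Z, (G.P *ᵥ u) j = u j - 1 := by
  have hL := hG.isIrreducibleLaplacian_one_sub_P
  refine ⟨green (1 - G.P) Z *ᵥ 1, fun j => ?_, fun j hj => ?_, fun j hj => ?_⟩
  · rw [Matrix.mulVec_apply_eq_sum]
    exact Finset.sum_nonneg fun l _ => mul_nonneg (hL.green_nonneg hZ j l) zero_le_one
  · rw [Matrix.mulVec_apply_eq_sum]
    exact Finset.sum_eq_zero fun l _ => by rw [green_of_mem_left _ hj, zero_mul]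
  · have hone := hL.mulVec_green_mulVec_apply hZ hj 1
    rw [Matrix.sub_mulVec, Matrix.one_mulVec, Pi.sub_apply, Pi.one_apply] at hone
    linarith

-- The expected hitting time `u` of `Z` decreases by one in mean at each step, which bounds the
-- total mass of the occupation vectors.
theorem StronglyConnected.summable_sum_occupation (hG : G.StronglyConnected) (i : Fin n)
    (hZ : Z.Nonempty) : Summable fun t => ∑ j, G.occupation i Z (t + 1) j := by
  obtain ⟨u, hu0, huZ, hPu⟩ := hG.exists_nonneg_mulVec_P_eq_sub_one hZ
  have hstep (t : ℕ) : ∑ j, G.occupation i Z (t + 1) j =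
      G.occupation i Z (t + 1) ⬝ᵥ u - G.occupation i Z (t + 2) ⬝ᵥ u := by
    rw [occupation_succ_dotProduct (fun l => (hG.deg_pos l).ne') i (t + 1) huZ,
      occupation_succ_dotProduct_congr (v := u - 1) i t hPu, dotProduct_sub, sub_sub_cancel,
      dotProduct_one]
  refine summable_of_sum_range_le (c := G.occupation i Z 1 ⬝ᵥ u)
    (fun t => Finset.sum_nonneg fun j _ => occupation_nonneg i Z _ j) fun T => ?_
  rw [Finset.sum_congr rfl fun t _ => hstep t,
    Finset.sum_range_sub' (fun t => G.occupation i Z (t + 1) ⬝ᵥ u)]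
  exact sub_le_self _ (Finset.sum_nonneg fun j _ =>
    mul_nonneg (occupation_nonneg i Z _ j) (hu0 j))

theorem StronglyConnected.tendsto_occupation (hG : G.StronglyConnected) (i : Fin n)
    (hZ : Z.Nonempty) :
    Filter.Tendsto (G.occupation i Z) Filter.atTop (nhds 0) := by
  rw [← Filter.tendsto_add_atTop_iff_nat 1, tendsto_pi_nhds]
  exact fun l => squeeze_zero (fun t => occupation_nonneg i Z _ l)
    (fun t => Finset.single_le_sum (fun j _ => occupation_nonneg i Z (t + 1) j)
      (Finset.mem_univ l))
    (hG.summable_sum_occupation i hZ).tendsto_atTop_zero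

end WeightedDigraph

namespace WeightedDigraph

open scoped Matrix

variable {n : ℕ} {G : WeightedDigraph n} {i : Fin n} {X : Finset (Fin n)}

theorem setOf_escape_eq_iUnion (i : Fin n) (X : Finset (Fin n)) :
    {w | ∃ t, 1 ≤ t ∧ w t ∈ X ∧ ∀ s, 1 ≤ s → s < t → w s ≠ i} =
      ⋃ t, avoids (insert i X) t ∩ {w | w (t + 1) ∈ X} := by
  ext w
  simp only [Set.mem_iUnion]
  constructor
  · intro hw
    classical
    obtain ⟨ht, htX, hti⟩ := Nat.find_spec hw
    have hfirst (s : ℕ) (hs : 1 ≤ s) (hst : s < Nat.find hw) : w s ∉ X := fun hsX =>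
      Nat.find_min hw hst ⟨hs, hsX, fun r hr hrs => hti r hr (hrs.trans hst)⟩
    refine ⟨Nat.find hw - 1, fun s hs hst => ?_, ?_⟩
    · have hlt : s < Nat.find hw := by omega
      exact mt Finset.mem_insert.1 (not_or.2 ⟨hti s hs hlt, hfirst s hs hlt⟩)
    · rwa [Set.mem_ofPred_eq, Nat.sub_add_cancel ht]
  · rintro ⟨t, havoid, htX⟩
    exact ⟨t + 1, t.succ_pos, htX, fun s hs hst hsi =>
      havoid s hs (Nat.lt_succ_iff.1 hst) (hsi ▸ Finset.mem_insert_self i X)⟩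

theorem pairwise_disjoint_avoids_inter (i : Fin n) (X : Finset (Fin n)) :
    Pairwise (Function.onFun Disjoint
      fun t => avoids (insert i X) t ∩ {w : ℕ → Fin n | w (t + 1) ∈ X}) := by
  refine (pairwise_disjoint_on _).2 fun s t hst => Set.disjoint_left.2 fun w hws hwt => ?_
  exact hwt.1 (s + 1) s.succ_pos hst (Finset.mem_insert_of_mem hws.2)

theorem hasSum_escapeProb (hdeg : ∀ l, G.deg l ≠ 0) (i : Fin n) (X : Finset (Fin n)) :
    HasSum (fun t => ∑ j ∈ X, (G.occupation i (insert i X) t ᵥ* G.P) j) (G.escapeProb i X) := by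
  have hmeas (t : ℕ) : MeasurableSet (avoids (insert i X) t ∩ {w | w (t + 1) ∈ X}) :=
    (measurableSet_avoids _ t).inter (measurableSet_eval_mem (t + 1) (X : Set (Fin n)))
  have hunion := measure_iUnion (μ := G.walkLaw i) (pairwise_disjoint_avoids_inter i X) hmeas
  rw [escapeProb, measureReal_def, setOf_escape_eq_iUnion, hunion, ENNReal.tsum_toReal_eq
    fun t => measure_ne_top _ _]
  simp only [← walkLaw_real_avoids_inter_succ hdeg, ← measureReal_inter_eval_mem_eq_sum]
  exact (ENNReal.summable_toReal (hunion ▸ measure_ne_top _ _)).hasSum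

theorem sum_occupation_vecMul_eq_sub (hdeg : ∀ l, G.deg l ≠ 0) {h : Fin n → ℝ}
    (hX : ∀ j ∈ X, h j = 1) (hi : h i = 0) (hiX : i ∉ X)
    (hharm : ∀ a ∉ insert i X, (G.P *ᵥ h) a = h a) (t : ℕ) :
    ∑ j ∈ X, (G.occupation i (insert i X) t ᵥ* G.P) j =
      G.occupation i (insert i X) t ⬝ᵥ (G.P *ᵥ h) -
        G.occupation i (insert i X) (t + 1) ⬝ᵥ (G.P *ᵥ h) := by
  rw [occupation_succ_dotProduct_congr i t hharm, Matrix.dotProduct_mulVec, eq_sub_iff_add_eq,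
    ← Fintype.sum_ite_mem, dotProduct, dotProduct, ← Finset.sum_add_distrib]
  refine Finset.sum_congr rfl fun j _ => ?_
  by_cases hjX : j ∈ X
  · rw [if_pos hjX, occupation_succ_of_mem i t (Finset.mem_insert_of_mem hjX), hX j hjX, zero_mul,
      add_zero, mul_one]
  rw [if_neg hjX, zero_add]
  obtain rfl | hji := eq_or_ne j i
  · rw [hi, mul_zero, mul_zero]
  · rw [occupation_succ_of_notMem hdeg i t (mt Finset.mem_insert.1 (not_or.2 ⟨hji, hjX⟩))]

variable [Nontrivial (Fin n)]

theorem StronglyConnected.escapeProb_eq_mulVec (hG : G.StronglyConnected) {h : Fin n → ℝ}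
    (hX : ∀ j ∈ X, h j = 1) (hi : h i = 0) (hiX : i ∉ X)
    (hharm : ∀ a ∉ insert i X, (G.P *ᵥ h) a = h a) :
    G.escapeProb i X = (G.P *ᵥ h) i := by
  have hdeg (l : Fin n) : G.deg l ≠ 0 := (hG.deg_pos l).ne'
  let a (t : ℕ) : ℝ := G.occupation i (insert i X) t ⬝ᵥ (G.P *ᵥ h)
  have ha0 : a 0 = (G.P *ᵥ h) i := by
    simp only [a, occupation_zero, single_one_dotProduct]
  have ha : Filter.Tendsto a Filter.atTop (nhds 0) := by
    have hcont : Continuous fun o : Fin n → ℝ => o ⬝ᵥ (G.P *ᵥ h) := by fun_prop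
    have hlim := (hcont.tendsto 0).comp (hG.tendsto_occupation i (Finset.insert_nonempty i X))
    rwa [zero_dotProduct] at hlim
  have hpartial (T : ℕ) : ∑ t ∈ Finset.range T, ∑ j ∈ X,
      (G.occupation i (insert i X) t ᵥ* G.P) j = (G.P *ᵥ h) i - a T := by
    rw [Finset.sum_congr rfl fun t _ => sum_occupation_vecMul_eq_sub hdeg hX hi hiX hharm t,
      Finset.sum_range_sub' a, ha0]
  have hlim := (hasSum_escapeProb hdeg i X).tendsto_sum_nat
  simp only [hpartial] at hlim
  simpa using tendsto_nhds_unique hlim (ha.const_sub _)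

namespace StronglyConnected

theorem mul_escapeProb_mul_green (hG : G.StronglyConnected) (hX : X.Nonempty) (hi : i ∉ X) :
    G.vol * G.stationary i * G.escapeProb i X * green G.laplacian X i i = 1 := by
  have hL := hG.isIrreducibleLaplacian_laplacian
  have hii := (hL.green_self_pos hX hi).ne'
  let g : Fin n → ℝ := fun j => green G.laplacian X j i
  let h : Fin n → ℝ := 1 - (g i)⁻¹ • g
  have hPh (a : Fin n) : (G.P *ᵥ h) a = 1 - (g i)⁻¹ * (G.P *ᵥ g) a := by
    rw [Matrix.mulVec_sub, Matrix.one_vecMul_of_mem_rowStochastic hG.P_mem_rowStochastic,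
      Matrix.mulVec_smul]
    rfl
  have hLg (a : Fin n) (ha : a ∉ X) :
      G.vol * G.stationary a * (g a - (G.P *ᵥ g) a) = (1 : Matrix (Fin n) (Fin n) ℝ) a i :=
    (laplacian_mulVec_apply g a).symm.trans (hL.mul_green_apply hX ha i)
  have hesc : G.escapeProb i X = (G.P *ᵥ h) i := by
    refine hG.escapeProb_eq_mulVec (fun j hj => ?_) ?_ hi fun a ha => ?_
    · simp [h, g, green_of_mem_left _ hj]
    · simp [h, g, hii]
    · obtain ⟨hai, haX⟩ := not_or.1 (mt Finset.mem_insert.2 ha)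
      have hharm := hLg a haX
      rw [Matrix.one_apply_ne hai] at hharm
      have hPg := sub_eq_zero.1 ((mul_eq_zero_iff_left
        (mul_pos hG.vol_pos (hG.stationary_pos a)).ne').1 hharm)
      rw [hPh, ← hPg]
      rfl
  have hone := hLg i hi
  rw [Matrix.one_apply_eq] at hone
  have hcancel : (1 - (g i)⁻¹ * (G.P *ᵥ g) i) * g i = g i - (G.P *ᵥ g) i := by
    rw [sub_mul, one_mul, mul_right_comm, inv_mul_cancel₀ hii, one_mul]
  rw [hesc, hPh, mul_assoc]
  exact (congrArg _ hcancel).trans hone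

theorem resistanceTo_eq_green (hG : G.StronglyConnected) (hX : X.Nonempty) (i : Fin n) :
    G.resistanceTo i X = green G.laplacian X i i := by
  rw [resistanceTo]
  split_ifs with hi
  · rw [green_of_mem_left _ hi]
  · exact (eq_one_div_of_mul_eq_one_right (hG.mul_escapeProb_mul_green hX hi)).symm

theorem groupResistance_eq_trace_green (hG : G.StronglyConnected) (hX : X.Nonempty) :
    G.groupResistance X = (green G.laplacian X).trace :=
  Finset.sum_congr rfl fun i _ => hG.resistanceTo_eq_green hX i

theorem vertexResistance_eq_trace_green (hG : G.StronglyConnected) (v : Fin n) :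
    G.vertexResistance v = (green G.laplacian {v}).trace := by
  have hL := hG.isIrreducibleLaplacian_laplacian
  have hres (j : Fin n) : G.resistance v j = green G.laplacian {j} v v := by
    rw [← hG.resistanceTo_eq_green (Finset.singleton_nonempty j)]
    simp only [resistance, resistanceTo, Finset.mem_singleton]
  rw [hL.trace_green_singleton hG.one_vecMul_laplacian,
    ← hL.sum_green_singleton_self hG.one_vecMul_laplacian]
  exact Finset.sum_congr rfl fun j _ => hres j

end StronglyConnected

end WeightedDigraph

theorem one_sub_one_div_pow_pred_le {k : ℕ} (hk : 2 ≤ k) :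
    (1 - 1 / (k : ℝ)) ^ (k - 1) ≤ (k : ℝ) / ((k : ℝ) - 1) * (1 / Real.exp 1) := by
  have hk2 : (2 : ℝ) ≤ k := by exact_mod_cast hk
  have hpow : (k : ℝ) / ((k : ℝ) - 1) * (1 - 1 / (k : ℝ)) ^ k = (1 - 1 / (k : ℝ)) ^ (k - 1) := by
    have hinv : (k : ℝ) / ((k : ℝ) - 1) * (1 - 1 / (k : ℝ)) = 1 := by
      have : (k : ℝ) - 1 ≠ 0 := by linarith
      field_simp
    rw [← mul_pow_sub_one (by omega), ← mul_assoc, hinv, one_mul]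
  rw [← hpow, one_div (Real.exp 1), ← Real.exp_neg]
  exact mul_le_mul_of_nonneg_left (Real.one_sub_div_pow_le_exp_neg (by linarith))
    (div_nonneg (by linarith) (by linarith))

theorem div_sub_one_mul_inv_exp_one_le_one {k : ℝ} (hk : 2 ≤ k) :
    k / (k - 1) * (1 / Real.exp 1) ≤ 1 := by
  have hfrac : k / (k - 1) ≤ 2 := by
    rw [div_le_iff₀ (by linarith)]
    linarith
  have hexp : 2 ≤ Real.exp 1 := by linarith [Real.add_one_le_exp (1 : ℝ)]
  rw [mul_one_div, div_le_one (Real.exp_pos 1)]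
  exact hfrac.trans hexp

theorem mainTheorem9_general (n k : ℕ) (hk : 2 ≤ k) (hkn : k ≤ n)
    (G : WeightedDigraph n) (hG : G.StronglyConnected) :
    (∃ X, Exact.Returns G.laplacian k X) ∧
    ∀ X, Exact.Returns G.laplacian k X →
      X.card = k ∧ ∀ (v : Fin n) (Y : Finset (Fin n)), Y.Nonempty → Y.card ≤ k →
        G.vertexResistance v - G.groupResistance X ≥
          (1 - (k : ℝ) / ((k : ℝ) - 1) * (1 / Real.exp 1)) *
            (G.vertexResistance v - G.groupResistance Y) := by
  have : Nontrivial (Fin n) := Fin.nontrivial_iff_two_le.2 (hk.trans hkn)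
  have hL := hG.isIrreducibleLaplacian_laplacian
  have hcol := hG.one_vecMul_laplacian
  refine ⟨Exact.exists_state _ (one_le_two.trans hk) hkn, ?_⟩
  rintro X ⟨M, hM⟩
  refine ⟨hM.card_eq, fun v Y hY hYk => ?_⟩
  rw [hG.vertexResistance_eq_trace_green, hG.groupResistance_eq_trace_green hM.nonempty,
    hG.groupResistance_eq_trace_green hY]
  have hle := hM.trace_green_le hL hcol v
  have hgreedy := hM.trace_green_sub_le hL hcol v hY hYk
  have hpow := one_sub_one_div_pow_pred_le hk
  have hconst := div_sub_one_mul_inv_exp_one_le_one (k := k) (by exact_mod_cast hk)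
  rcases le_total (green G.laplacian Y).trace (green G.laplacian {v}).trace with hYv | hYv
  · have := mul_le_mul_of_nonneg_right hpow (sub_nonneg.2 hYv)
    linarith
  · have := mul_nonpos_of_nonneg_of_nonpos (sub_nonneg.2 hconst) (sub_nonpos.2 hYv)
    linarith

theorem mainTheorem9 (n k : ℕ) (hk : 2 ≤ k) (hkn : k ≤ n)
    (G : WeightedDigraph n) (hG : G.StronglyConnected)
    (vs : Fin n) (hvs : ∀ v, G.vertexResistance vs ≤ G.vertexResistance v)
    (Xs : Finset (Fin n))
    (hXs : (Xs.card = k ∧ ∀ Y : Finset (Fin n), Y.card = k →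
        G.groupResistance Xs ≤ G.groupResistance Y) ∨
      (Xs.Nonempty ∧ Xs.card ≤ k ∧ ∀ Y : Finset (Fin n), Y.Nonempty → Y.card ≤ k →
        G.groupResistance Xs ≤ G.groupResistance Y)) :
    (∃ X, Exact.Returns G.laplacian k X) ∧
    ∀ X, Exact.Returns G.laplacian k X →
      X.card = k ∧
      G.vertexResistance vs - G.groupResistance X ≥
        (1 - (k : ℝ) / ((k : ℝ) - 1) * (1 / Real.exp 1)) *
          (G.vertexResistance vs - G.groupResistance Xs) := by
  have hne : Xs.Nonempty := hXs.elim (fun h => Finset.card_pos.1 (by omega)) fun h => h.1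
  have hcard : Xs.card ≤ k := hXs.elim (fun h => h.1.le) fun h => h.2.1
  obtain ⟨hex, hbound⟩ := mainTheorem9_general n k hk hkn G hG
  exact ⟨hex, fun X hX => ⟨(hbound X hX).1, (hbound X hX).2 vs Xs hne hcard⟩⟩
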